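/- Let $D$ be a finite alphabet carrying the structure of an abelian group (for instance $\mathbb Z/|D|\mathbb Z$), let $|E|=2$, let $\mathcal D\subseteq D^n$, and let $f:\mathcal D\to E$ be a boolean function. For an integer $k>0$ let $f^{(k)}:\mathcal D^k\to E^k$, $f^{(k)}(x^1,\dots,x^k)=(f(x^1),\dots,f(x^k))$, regarded as a function of $kn$ variables. For a function $g$ on a set of inputs $x$ with letters in $D$, let $Q_\epsilon(g)$ be the minimum number of queries $O_x:|i,b,w\rangle\mapsto|i,b+x_i,w\rangle$ made by a quantum algorithm (arbitrary input-independent unitaries on a finite-dimensional space interleaved with queries, then a measurement; an index value for which $O_x$ acts as the identity is also allowed) which on every input $x$ in the domain of $g$ outputs $g(x)$ with probability at least $1-\epsilon$; $Q_\epsilon(g)=\infty$ if there is no such algorithm (in particular if $\epsilon<0$ and the domain is non-empty). Let $F(x,y)=1$ if $f(x)=f(y)$ and $0$ otherwise, let $J$ be the all-ones matrix, and let $\Delta_i(x,y)=1$ if $x_i=y_i$ and $0$ otherwise ($x,y\in\mathcal D$). The additive adversary bound is $$\mathrm{ADV}(F)=\max\bigl\{\,\|\Gamma\circ(J-F)\|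 \;:\; \Gamma \text{ Hermitian},\ I\pm\Gamma\circ(J-\Delta_i)\succeq 0 \text{ for all } i\in[n]\,\bigr\},$$ where $\circ$ is the entrywise product and $\|\cdot\|$ the spectral norm. Then for every real $0\le\delta<1$ and all integers $k,K>0$, $$Q_{\,1-\left(e^{1/K}(1+\sqrt\delta)/2\right)^k}\bigl(f^{(k)}\bigr)\;\ge\;\frac{k\,\delta}{K(1-\delta)}\,\mathrm{ADV}(F).$$ -/

import Mathlib

open scoped ENNReal Matrix ComplexOrder

/-! ## Quantum query algorithms -/

namespace QuantumQuery

/-- Computational basis of the state space: a query index (`none` means that no variable is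
queried), an answer register holding a letter of the alphabet `D`, and a workspace of finite
dimension `m`. -/
abbrev BasisState (ι D : Type*) (m : ℕ) : Type _ := Option ι × D × Fin m

/-- The shift of the answer register: by `x i` if the index register holds `some i`, and by `0` if
it holds `none`. -/
def shift {ι D : Type*} [AddCommGroup D] (x : ι → D) : Option ι → D
  | none => 0
  | some i => x i

/-- The query operator `O_x : |i, b, w⟩ ↦ |i, b + x_i, w⟩` (the identity where `i = none`), acting on
the vector of amplitudes: the new amplitude of `|i, b, w⟩` is the old one of `|i, b - x_i, w⟩`. -/
def applyQuery {ι D : Type*} [AddCommGroup D] {m : ℕ} (x : ι → D)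
    (ψ : BasisState ι D m → ℂ) : BasisState ι D m → ℂ :=
  fun s => ψ (s.1, s.2.1 - shift x s.1, s.2.2)

/-- A quantum query algorithm for inputs `x : ι → D` with outputs in `O`: it starts in a basis state,
alternates input-independent unitaries with queries,
`U_T O_x U_{T-1} O_x ⋯ U_1 O_x U_0 |start⟩`, and finally measures in the computational basis and
outputs the label of the basis state observed. -/
structure Algorithm (ι D O : Type*) [Fintype ι] [DecidableEq ι] [Fintype D] [DecidableEq D] where
  /-- the number `T` of queries -/
  queries : ℕ
  /-- the dimension of the workspace -/
  workDim : ℕ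
  /-- the initial basis state -/
  start : BasisState ι D workDim
  /-- the unitaries; only `U 0, …, U T` are used -/
  U : ℕ → Matrix.unitaryGroup (BasisState ι D workDim) ℂ
  /-- the output attached to each outcome of the final measurement -/
  output : BasisState ι D workDim → O

namespace Algorithm

variable {ι D O : Type*} [Fintype ι] [DecidableEq ι] [Fintype D] [DecidableEq D] [AddCommGroup D]

/-- The state on input `x` after `t` queries and the unitary following the `t`-th query. -/
def state (A : Algorithm ι D O) (x : ι → D) : ℕ → BasisState ι D A.workDim → ℂ
  | 0 => (A.U 0).1 *ᵥ Pi.single A.start 1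
  | t + 1 => (A.U (t + 1)).1 *ᵥ applyQuery x (state A x t)

open Classical in
/-- The probability that the algorithm outputs `o` on input `x`. -/
noncomputable def outputProb (A : Algorithm ι D O) (x : ι → D) (o : O) : ℝ :=
  ∑ s with A.output s = o, ‖A.state x A.queries s‖ ^ 2

/-- On every input of the domain the algorithm outputs the value of `g` with probability at least
`1 - ε`. -/
def Computes (A : Algorithm ι D O) {S : Finset (ι → D)} (g : S → O) (ε : ℝ) : Prop :=
  ∀ x : S, 1 - ε ≤ A.outputProb x.1 (g x)

end Algorithm

/-- `Q_ε(g)`: the minimum number of queries of a quantum algorithm computing `g` with error at most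
`ε` on every input (`⊤` if there is no such algorithm). -/
noncomputable def queryComplexity {ι D O : Type*} [Fintype ι] [DecidableEq ι] [Fintype D]
    [DecidableEq D] [AddCommGroup D] (ε : ℝ) {S : Finset (ι → D)} (g : S → O) : ℕ∞ :=
  ⨅ (A : Algorithm ι D O) (_ : A.Computes g ε), (A.queries : ℕ∞)

/-! ## Independent copies of a function -/

/-- The `p`-th block of an input made of `k` blocks of length `n`. -/
def block {n k : ℕ} {D : Type*} (z : Fin k × Fin n → D) (p : Fin k) : Fin n → D :=
  fun q => z (p, q)

/-- The domain `S ^ k`, as a set of inputs with `k * n` variables. -/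
def powDomain {n : ℕ} {D : Type*} [Fintype D] [DecidableEq D] (S : Finset (Fin n → D)) (k : ℕ) :
    Finset (Fin k × Fin n → D) :=
  {z | ∀ p, block z p ∈ S}

/-- `f^(k) (x¹, …, xᵏ) = (f x¹, …, f xᵏ)`. -/
def copies {n : ℕ} {D E : Type*} [Fintype D] [DecidableEq D] {S : Finset (Fin n → D)}
    (f : S → E) (k : ℕ) : powDomain S k → Fin k → E :=
  fun z p => f ⟨block z.1 p, (Finset.mem_filter.mp z.2).2 p⟩

/-! ## The additive adversary bound -/

/-- The all-ones matrix `J`. -/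
def allOnes (X : Type*) : Matrix X X ℂ := Matrix.of fun _ _ => 1

/-- `Δ_i (x, y) = 1` if `x_i = y_i`, and `0` otherwise. -/
def agree {ι D : Type*} [DecidableEq D] (S : Finset (ι → D)) (i : ι) : Matrix S S ℂ :=
  Matrix.of fun x y => if x.1 i = y.1 i then 1 else 0

/-- The Gram matrix `F (x, y) = 1` if `f x = f y`, and `0` otherwise. -/
def functionGram {ι D E : Type*} [DecidableEq E] {S : Finset (ι → D)} (f : S → E) :
    Matrix S S ℂ :=
  Matrix.of fun x y => if f x = f y then 1 else 0

/-- `Γ` is hermitian and `I ± Γ ∘ (J - Δ_i) ⪰ 0` for every `i` (entrywise product). -/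
def IsAdversaryMatrix {ι D : Type*} [DecidableEq ι] [DecidableEq D] [Fintype ι]
    {S : Finset (ι → D)} (Γ : Matrix S S ℂ) : Prop :=
  Γ.IsHermitian ∧ ∀ i : ι,
    (1 + Γ ⊙ (allOnes S - agree S i)).PosSemidef ∧
    (1 - Γ ⊙ (allOnes S - agree S i)).PosSemidef

/-- The additive adversary bound `ADV(σ)`: the maximum of the spectral norm `‖Γ ∘ (J - σ)‖` over
adversary matrices `Γ`. -/
noncomputable def additiveAdversary {ι D : Type*} [Fintype ι] [DecidableEq ι] [DecidableEq D]
    {S : Finset (ι → D)} (σ : Matrix S S ℂ) : ℝ≥0∞ :=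
  ⨆ (Γ : Matrix S S ℂ) (_ : IsAdversaryMatrix Γ),
    ENNReal.ofReal ‖Matrix.toEuclideanCLM (𝕜 := ℂ) (Γ ⊙ (allOnes S - σ))‖

end QuantumQuery

/-!
Write `H = Γ ∘ (J - F)` and `d = ‖H‖`. As `f` takes two values, conjugation by the sign of a fibre
of `f` negates `H`, so that `H` is the odd part of `Γ` and `d` itself is an eigenvalue of `H`. For
`μ > 0` put `M = (d + μ) I - H ⪰ μ I`; then `M v = μ v` for a norm eigenvector `v` of `H`.

Run the algorithm for `f^(k)` on an input register in the state `v^{⊗k}` and follow the expectation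
of the multiplicative adversary matrix `M^{⊗k}` in that register. It starts at `μ ^ k`. A query to
`x^p_i` does not affect the entries of the density matrix between inputs agreeing there; the other
entries of the `p`-th factor `M` are those of `-N`, where `N = H ∘ (J - Δ_i)` is the odd part of
`Γ ∘ (J - Δ_i)` and so satisfies `-I ⪯ N ⪯ I ⪯ μ⁻¹ M`. Hence a query multiplies the expectation at
most by `1 + 2 / μ`. Since `M` dominates `c = μ (2 d + μ) / (d + μ)` times the projection onto each
fibre of `f`, an algorithm with success probability `η` ends with expectation at least `c ^ k η`.

Thus `η ≤ ((d + μ) / (2 d + μ)) ^ k (1 + 2 / μ) ^ T` after `T` queries. The choice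
`μ = 2 d s / (1 - s)` makes the first ratio `(1 + s) / 2` and yields `T ≥ k s d / (K (1 - s))`; with
`s = √δ` this is at least `k δ d / (K (1 - δ))`.
-/

namespace QuantumQuery

open scoped MatrixOrder Matrix.Norms.L2Operator

section Involution

theorem conj_half_sub_conj {A : Type*} [Ring A] [Algebra ℝ A] {w : A} (hww : w * w = 1) (a : A) :
    w * ((1 / 2 : ℝ) • (a - w * a * w)) * w = -((1 / 2 : ℝ) • (a - w * a * w)) := by
  have hconj : w * (w * a * w) * w = a := by
    rw [mul_assoc w a w, ← mul_assoc w w, hww, one_mul, mul_assoc, hww, mul_one]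
  rw [mul_smul_comm, smul_mul_assoc, mul_sub, sub_mul, hconj, ← smul_neg, neg_sub]

variable {A : Type*} [CStarAlgebra A] {w a : A}

theorem norm_mem_spectrum_of_conj_eq_neg [Nontrivial A] (ha : IsSelfAdjoint a) (hww : w * w = 1)
    (hwa : w * a * w = -a) : ‖a‖ ∈ spectrum ℝ a := by
  let u : Aˣ := ⟨w, w, hww, hww⟩
  have hneg : -spectrum ℝ a = spectrum ℝ a := by
    rw [spectrum.neg_eq, ← hwa]
    exact spectrum.units_conjugate (u := u)
  rcases CStarAlgebra.norm_or_neg_norm_mem_spectrum ha with h | h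
  · exact h
  · rwa [← hneg, Set.mem_neg]

variable [PartialOrder A] [StarOrderedRing A]

theorem half_sub_conj_le (hw : IsSelfAdjoint w) (hww : w * w = 1) (ha₁ : -1 ≤ a) (ha₂ : a ≤ 1) :
    (1 / 2 : ℝ) • (a - w * a * w) ≤ 1 := by
  have hconj : -1 ≤ w * a * w := by
    have h := hw.conjugate_nonneg (neg_le_iff_add_nonneg.1 ha₁)
    rwa [mul_add, add_mul, mul_one, hww, ← neg_le_iff_add_nonneg] at h
  calc (1 / 2 : ℝ) • (a - w * a * w) ≤ (1 / 2 : ℝ) • (1 - -1) :=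
        smul_le_smul_of_nonneg_left (sub_le_sub ha₂ hconj) (by norm_num)
    _ = 1 := by module

theorem neg_one_le_half_sub_conj (hw : IsSelfAdjoint w) (hww : w * w = 1) (ha₁ : -1 ≤ a)
    (ha₂ : a ≤ 1) : -1 ≤ (1 / 2 : ℝ) • (a - w * a * w) := by
  have h := half_sub_conj_le hw hww (neg_le_neg ha₂) (neg_le.1 ha₁)
  rw [neg_le]
  convert h using 1
  rw [mul_neg, neg_mul]
  module

theorem smul_half_one_add_le_smul_one_sub (hw : IsSelfAdjoint w) (hww : w * w = 1)
    (hwa : w * a * w = -a) {d μ : ℝ} (hd : 0 < d) (hμ : 0 < μ) (had : a ≤ d • 1) :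
    (μ * (2 * d + μ) / (d + μ)) • (1 / 2 : ℝ) • (1 + w) ≤ (d + μ) • 1 - a := by
  have hanti : a * w = -(w * a) := by
    have h := congrArg (w * ·) hwa
    simpa only [← mul_assoc, hww, one_mul, mul_neg] using h
  -- Conjugation by `d p + (d + μ) (1 - p)`, with `p = (1 + w) / 2`, scales the off-diagonal `a`
  -- by `d (d + μ)`, and the diagonal blocks by `d ^ 2` and `(d + μ) ^ 2`.
  have hc : IsSelfAdjoint ((d + μ / 2) • (1 : A) - (μ / 2) • w) :=
    (IsSelfAdjoint.smul (.all _) (.one A)).sub (IsSelfAdjoint.smul (.all _) hw)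
  have hconj := hc.conjugate_nonneg (sub_nonneg.2 had)
  rw [← sub_nonneg]
  have hscale : 0 ≤ (d * (d + μ))⁻¹ := by positivity
  convert smul_nonneg hscale hconj using 1
  simp only [mul_sub, sub_mul, smul_mul_assoc, mul_smul_comm, mul_one, one_mul, hww, hwa, hanti]
  match_scalars <;> field_simp <;> ring

theorem exists_mulVec_eq_norm_smul_of_conj_eq_neg {X : Type*} [Fintype X] [DecidableEq X]
    [Nonempty X] {H W : Matrix X X ℂ} (hH : IsSelfAdjoint H) (hWW : W * W = 1)
    (hWH : W * H * W = -H) : ∃ v ≠ 0, H *ᵥ v = (‖H‖ : ℂ) • v := by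
  have hspec := spectrum.algebraMap_mem ℂ (norm_mem_spectrum_of_conj_eq_neg hH hWW hWH)
  rw [← Matrix.spectrum_toLin', ← Module.End.hasEigenvalue_iff_mem_spectrum] at hspec
  obtain ⟨v, hv⟩ := hspec.exists_hasEigenvector
  exact ⟨v, hv.2, hv.apply_eq_smul⟩

end Involution

section PositiveFunctional

variable {V : Type*} [AddCommGroup V] [PartialOrder V] [Module ℝ V]

theorem le_one_add_two_div_mul_of_monotone {φ φ' : V →ₗ[ℝ] ℝ} (hφ : Monotone φ)
    (hφ' : Monotone φ') {e m b : V} {μ : ℝ} (hμ : 0 < μ) (hb₁ : -e ≤ b) (hb₂ : b ≤ e)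
    (hm : μ • e ≤ m) (he : φ e = φ' e) (hmb : φ (m + b) = φ' (m + b)) :
    φ' m ≤ (1 + 2 / μ) * φ m := by
  have hb₁' : -φ' e ≤ φ' b := by simpa only [map_neg] using hφ' hb₁
  have hb₂' : φ b ≤ φ e := hφ hb₂
  have hm' : φ e ≤ φ m / μ := by
    rw [le_div_iff₀' hμ]
    simpa only [map_smul, smul_eq_mul] using hφ hm
  calc φ' m = φ' (m + b) - φ' b := by rw [map_add, add_sub_cancel_right]
    _ ≤ φ' (m + b) + φ' e := by linarith
    _ = φ m + φ b + φ e := by rw [← hmb, ← he, map_add]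
    _ ≤ φ m + 2 * (φ m / μ) := by linarith
    _ = (1 + 2 / μ) * φ m := by ring

end PositiveFunctional

section Expectation

variable {Z B : Type*} [Fintype B]

theorem mul_conjTranspose_eq_sum_vecMulVec (Ψ : Matrix Z B ℂ) :
    Ψ * Ψᴴ = ∑ b, Matrix.vecMulVec (Ψ.col b) (star (Ψ.col b)) := by
  ext z z'
  simp [Matrix.mul_apply, Matrix.sum_apply, Matrix.vecMulVec_apply]

variable [Fintype Z]

/-- The expectation `Re Tr (G ρ)` of an observable `G` in an (unnormalised) mixed state `ρ`, as a
real bilinear form. -/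
noncomputable def expectation : Matrix Z Z ℂ →ₗ[ℝ] Matrix Z Z ℂ →ₗ[ℝ] ℝ :=
  (LinearMap.mul ℝ (Matrix Z Z ℂ)).compr₂ (Complex.reLm ∘ₗ Matrix.traceLinearMap Z ℝ ℂ)

theorem expectation_apply (G ρ : Matrix Z Z ℂ) : expectation G ρ = (G * ρ).trace.re := rfl

theorem expectation_nonneg {G ρ : Matrix Z Z ℂ} (hG : 0 ≤ G) (hρ : 0 ≤ ρ) :
    0 ≤ expectation G ρ := by
  classical
  obtain ⟨C, rfl⟩ := CStarAlgebra.nonneg_iff_eq_star_mul_self.1 hρ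
  rw [expectation_apply, ← mul_assoc, Matrix.trace_mul_comm, ← mul_assoc]
  have hconj := Matrix.nonneg_iff_posSemidef.1 (star_right_conjugate_nonneg hG C)
  exact (Complex.le_def.1 hconj.trace_nonneg).1

theorem expectation_mono_left {G G' ρ : Matrix Z Z ℂ} (hG : G ≤ G') (hρ : 0 ≤ ρ) :
    expectation G ρ ≤ expectation G' ρ := by
  rw [← sub_nonneg, ← LinearMap.sub_apply, ← map_sub]
  exact expectation_nonneg (sub_nonneg.2 hG) hρ

theorem expectation_congr_right {G ρ ρ' : Matrix Z Z ℂ}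
    (h : ∀ z z', G z z' ≠ 0 → ρ z' z = ρ' z' z) : expectation G ρ = expectation G ρ' := by
  simp only [expectation_apply, Matrix.trace, Matrix.diag_apply, Matrix.mul_apply]
  congr! 3 with z _ z' _
  by_cases h0 : G z z' = 0
  · simp only [h0, zero_mul]
  · rw [h z z' h0]

theorem expectation_vecMulVec_star (G : Matrix Z Z ℂ) (a : Z → ℂ) :
    expectation G (Matrix.vecMulVec a (star a)) = (star a ⬝ᵥ G *ᵥ a).re := by
  rw [expectation_apply, Matrix.mul_vecMulVec, Matrix.trace_vecMulVec, dotProduct_comm]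

theorem re_star_dotProduct_ofReal_mul (w : Z → ℝ) (a : Z → ℂ) :
    (star a ⬝ᵥ fun z => (w z : ℂ) * a z).re = ∑ z, w z * ‖a z‖ ^ 2 := by
  simp only [dotProduct, Complex.re_sum, Pi.star_apply, RCLike.star_def]
  refine Finset.sum_congr rfl fun z _ => ?_
  rw [mul_left_comm, Complex.conj_mul', ← Complex.ofReal_pow, ← Complex.ofReal_mul,
    Complex.ofReal_re]

theorem sum_sum_mul_norm_sq_le_expectation [DecidableEq Z] {G : Matrix Z Z ℂ} {w : B → Z → ℝ}
    (hw : ∀ b, Matrix.diagonal (fun z => (w b z : ℂ)) ≤ G) (Ψ : Matrix Z B ℂ) :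
    ∑ b, ∑ z, w b z * ‖Ψ z b‖ ^ 2 ≤ expectation G (Ψ * Ψᴴ) := by
  rw [mul_conjTranspose_eq_sum_vecMulVec, map_sum]
  refine Finset.sum_le_sum fun b _ => ?_
  calc ∑ z, w b z * ‖Ψ z b‖ ^ 2
      = expectation (Matrix.diagonal fun z => (w b z : ℂ))
          (Matrix.vecMulVec (Ψ.col b) (star (Ψ.col b))) := by
        have hmul : (Matrix.diagonal fun z => (w b z : ℂ)) *ᵥ Ψ.col b =
            fun z => (w b z : ℂ) * Ψ.col b z := funext fun z => Matrix.mulVec_diagonal _ _ z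
        rw [expectation_vecMulVec_star, hmul, re_star_dotProduct_ofReal_mul]
        rfl
    _ ≤ expectation G (Matrix.vecMulVec (Ψ.col b) (star (Ψ.col b))) :=
        expectation_mono_left (hw b) (Matrix.posSemidef_vecMulVec_self_star _).nonneg

end Expectation

section PiKronecker

open Function

variable (R : Type*) [CommSemiring R] {κ 𝕜 : Type*} [Fintype κ] {X Y : κ → Type*}

/-- The Kronecker product of a finite family of matrices, as a multilinear map, so that a single
factor can be varied: its rows and columns are indexed by the families of indices of the factors. -/
noncomputable def piKronecker [CommSemiring 𝕜] [Algebra R 𝕜] :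
    MultilinearMap R (fun p => Matrix (X p) (Y p) 𝕜) (Matrix (∀ p, X p) (∀ p, Y p) 𝕜) :=
  (Matrix.ofLinearEquiv R).toLinearMap.compMultilinearMap <|
    MultilinearMap.pi fun x => MultilinearMap.pi fun y =>
      (MultilinearMap.mkPiAlgebra R κ 𝕜).compLinearMap
        fun p => Matrix.entryLinearMap R 𝕜 (x p) (y p)

section CommSemiring

variable [CommSemiring 𝕜] [Algebra R 𝕜]

theorem piKronecker_apply (N : ∀ p, Matrix (X p) (Y p) 𝕜) (x : ∀ p, X p) (y : ∀ p, Y p) :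
    piKronecker R N x y = ∏ p, N p (x p) (y p) := rfl

theorem piKronecker_diagonal [∀ p, DecidableEq (X p)] [DecidableEq (∀ p, X p)]
    (w : ∀ p, X p → 𝕜) :
    piKronecker R (fun p => Matrix.diagonal (w p)) =
      Matrix.diagonal fun x => ∏ p, w p (x p) := by
  ext x y
  rw [piKronecker_apply]
  rcases eq_or_ne x y with rfl | hxy
  · simp only [Matrix.diagonal_apply_eq]
  · obtain ⟨p, hp⟩ := ne_iff.1 hxy
    rw [Matrix.diagonal_apply_ne _ hxy]
    exact Finset.prod_eq_zero (Finset.mem_univ p) (Matrix.diagonal_apply_ne _ hp)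

theorem piKronecker_update_apply_eq_zero [DecidableEq κ] {N : ∀ p, Matrix (X p) (Y p) 𝕜} {p : κ}
    {L : Matrix (X p) (Y p) 𝕜} {x : ∀ p, X p} {y : ∀ p, Y p} (h : L (x p) (y p) = 0) :
    piKronecker R (update N p L) x y = 0 := by
  rw [piKronecker_apply]
  exact Finset.prod_eq_zero (Finset.mem_univ p) (by rwa [update_self])

theorem piKronecker_mul [DecidableEq κ] [∀ p, Fintype (Y p)] {W : κ → Type*}
    (N : ∀ p, Matrix (X p) (Y p) 𝕜) (N' : ∀ p, Matrix (Y p) (W p) 𝕜) :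
    piKronecker R N * piKronecker R N' = piKronecker R fun p => N p * N' p := by
  ext x y
  simp only [Matrix.mul_apply, piKronecker_apply, Fintype.prod_sum, Finset.prod_mul_distrib]

theorem piKronecker_mulVec [DecidableEq κ] [∀ p, Fintype (Y p)]
    (N : ∀ p, Matrix (X p) (Y p) 𝕜) (v : ∀ p, Y p → 𝕜) :
    (piKronecker R N *ᵥ fun y => ∏ p, v p (y p)) = fun x => ∏ p, (N p *ᵥ v p) (x p) := by
  ext x
  simp only [Matrix.mulVec, dotProduct, piKronecker_apply, Fintype.prod_sum,
    Finset.prod_mul_distrib]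

theorem piKronecker_conjTranspose [StarRing 𝕜] (N : ∀ p, Matrix (X p) (Y p) 𝕜) :
    (piKronecker R N)ᴴ = piKronecker R fun p => (N p)ᴴ := by
  ext x y
  simp only [Matrix.conjTranspose_apply, piKronecker_apply, star_prod]

end CommSemiring

theorem piKronecker_nonneg [∀ p, Finite (X p)] [Algebra R ℂ] {N : ∀ p, Matrix (X p) (X p) ℂ}
    (hN : ∀ p, 0 ≤ N p) : 0 ≤ piKronecker R N := by
  classical
  have _ (p : κ) : Fintype (X p) := .ofFinite _
  choose C hC using fun p => CStarAlgebra.nonneg_iff_eq_star_mul_self.1 (hN p)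
  obtain rfl : N = fun p => (C p)ᴴ * C p := funext hC
  rw [← piKronecker_mul, ← piKronecker_conjTranspose]
  exact star_mul_self_nonneg _

end PiKronecker

section PiKroneckerOrder

open Function

variable {R : Type*} [CommRing R] [Algebra R ℂ] {κ : Type*} [Fintype κ] {X : κ → Type*}
  [∀ p, Finite (X p)] {N N' : ∀ p, Matrix (X p) (X p) ℂ}

theorem piKronecker_update_mono [DecidableEq κ] (hN : ∀ p, 0 ≤ N p) (p : κ) :
    Monotone fun L => piKronecker R (update N p L) := by
  intro L L' hL
  rw [← sub_nonneg, ← MultilinearMap.map_update_sub]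
  refine piKronecker_nonneg R fun q => ?_
  rcases eq_or_ne q p with rfl | hq
  · rw [update_self]; exact sub_nonneg.2 hL
  · rw [update_of_ne hq]; exact hN q

theorem piKronecker_mono (hN : ∀ p, 0 ≤ N p) (hNN' : ∀ p, N p ≤ N' p) :
    piKronecker R N ≤ piKronecker R N' := by
  classical
  have hmixed (s : Finset κ) (p : κ) : 0 ≤ s.piecewise N' N p := by
    by_cases hp : p ∈ s
    · simpa only [hp, Finset.piecewise_eq_of_mem] using (hN p).trans (hNN' p)
    · simpa only [hp, not_false_eq_true, Finset.piecewise_eq_of_notMem] using hN p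
  suffices ∀ s : Finset κ, piKronecker R N ≤ piKronecker R (s.piecewise N' N) by
    simpa only [Finset.piecewise_univ] using this Finset.univ
  intro s
  induction s using Finset.induction_on with
  | empty => rw [Finset.piecewise_empty]
  | insert p s hp ih =>
    calc piKronecker R N ≤ piKronecker R (s.piecewise N' N) := ih
      _ = piKronecker R (update (s.piecewise N' N) p (N p)) := by
        rw [← Finset.piecewise_eq_of_notMem s N' N hp, update_eq_self]
      _ ≤ piKronecker R (update (s.piecewise N' N) p (N' p)) :=
        piKronecker_update_mono (hmixed s) p (hNN' p)
      _ = piKronecker R ((insert p s).piecewise N' N) := by rw [Finset.piecewise_insert]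

theorem diagonal_pow_le_piKronecker {X E : Type*} [Finite X] [DecidableEq X] [DecidableEq E]
    {f : X → E} {M : Matrix X X ℂ} {c : ℝ} (hc : 0 ≤ c)
    (hM : ∀ e, Matrix.diagonal (fun x => if f x = e then (c : ℂ) else 0) ≤ M) (o : κ → E)
    [DecidableEq (κ → X)] :
    Matrix.diagonal (fun z : κ → X =>
        if (fun p => f (z p)) = o then ((c ^ Fintype.card κ : ℝ) : ℂ) else 0) ≤
      piKronecker R fun _ : κ => M := by
  have hprod : (Matrix.diagonal fun z : κ → X =>
      if (fun p => f (z p)) = o then ((c ^ Fintype.card κ : ℝ) : ℂ) else 0) =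
      piKronecker R fun p => Matrix.diagonal fun x => if f x = o p then (c : ℂ) else 0 := by
    rw [piKronecker_diagonal]
    congr 1
    ext z
    rw [Fintype.prod_ite_zero, Finset.prod_const, Finset.card_univ, Complex.ofReal_pow]
    simp only [funext_iff]
  rw [hprod]
  refine piKronecker_mono (fun p => ?_) fun p => hM (o p)
  refine (Matrix.PosSemidef.diagonal fun x => ?_).nonneg
  rw [Pi.zero_apply]
  split_ifs
  exacts [Complex.zero_le_real.2 hc, le_rfl]

end PiKroneckerOrder

section ControlledQuery

variable {Z ι D : Type*}

/-- The query operator `O_x` with the input `x` read off an input register: the row of index `z`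
undergoes a query to the input `x z`. -/
def controlledQuery [AddCommGroup D] {m : ℕ} (x : Z → ι → D) (Ψ : Matrix Z (BasisState ι D m) ℂ) :
    Matrix Z (BasisState ι D m) ℂ :=
  Matrix.of fun z => applyQuery (x z) (Ψ z)

theorem mul_conjTranspose_eq_sum_submatrix {I W : Type*} [Fintype I] [Fintype W]
    (Ψ : Matrix Z (I × W) ℂ) :
    Ψ * Ψᴴ = ∑ i, Ψ.submatrix id (Prod.mk i) * (Ψ.submatrix id (Prod.mk i))ᴴ := by
  ext z z'
  simp only [Matrix.mul_apply, Matrix.sum_apply, Matrix.conjTranspose_apply, Fintype.sum_prod_type,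
    Matrix.submatrix_apply, id_eq]

theorem controlledQuery_submatrix_mul_conjTranspose_apply [Fintype D] [AddCommGroup D] {m : ℕ}
    {x : Z → ι → D} (Ψ : Matrix Z (BasisState ι D m) ℂ) {i : Option ι} {z z' : Z}
    (h : shift (x z) i = shift (x z') i) :
    ((controlledQuery x Ψ).submatrix id (Prod.mk i) *
        ((controlledQuery x Ψ).submatrix id (Prod.mk i))ᴴ) z z' =
      (Ψ.submatrix id (Prod.mk i) * (Ψ.submatrix id (Prod.mk i))ᴴ) z z' := by
  simp only [Matrix.mul_apply, Matrix.conjTranspose_apply, Matrix.submatrix_apply, id_eq,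
    controlledQuery, Matrix.of_apply, applyQuery, h]
  exact ((Equiv.subRight (shift (x z') i)).prodCongr (Equiv.refl (Fin m))).sum_comp
    fun b => Ψ z (i, b) * star (Ψ z' (i, b))

variable [Fintype Z]

/-- A query multiplies the expectation of `G` in the state of the input register at most by `C`.
A query to the variable `i` is modelled by its only relevant effect: it leaves unchanged the
entries of the density matrix between inputs with the same value of that variable. -/
def QueryGrowthLE (x : Z → ι → D) (G : Matrix Z Z ℂ) (C : ℝ) : Prop :=
  ∀ i, ∀ ρ ρ' : Matrix Z Z ℂ, 0 ≤ ρ → 0 ≤ ρ' → (∀ z z', x z i = x z' i → ρ z z' = ρ' z z') →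
    expectation G ρ' ≤ C * expectation G ρ

theorem expectation_controlledQuery_le [Fintype ι] [Fintype D] [AddCommGroup D] {x : Z → ι → D}
    {G : Matrix Z Z ℂ} {C : ℝ} (hG : 0 ≤ G) (hC : 1 ≤ C) (hgrowth : QueryGrowthLE x G C) {m : ℕ}
    (Ψ : Matrix Z (BasisState ι D m) ℂ) :
    expectation G (controlledQuery x Ψ * (controlledQuery x Ψ)ᴴ) ≤ C * expectation G (Ψ * Ψᴴ) := by
  rw [mul_conjTranspose_eq_sum_submatrix, mul_conjTranspose_eq_sum_submatrix Ψ, map_sum, map_sum,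
    Finset.mul_sum]
  refine Finset.sum_le_sum fun i _ => ?_
  have hpos (Φ : Matrix Z (D × Fin m) ℂ) : 0 ≤ Φ * Φᴴ :=
    (Matrix.posSemidef_self_mul_conjTranspose Φ).nonneg
  cases i with
  | none =>
    have hnone := Matrix.ext fun z z' =>
      controlledQuery_submatrix_mul_conjTranspose_apply (x := x) Ψ (i := none) (z := z) (z' := z')
        rfl
    rw [hnone]
    exact le_mul_of_one_le_left (expectation_nonneg hG (hpos _)) hC
  | some i =>
    exact hgrowth i _ _ (hpos _) (hpos _) fun z z' h =>
      (controlledQuery_submatrix_mul_conjTranspose_apply Ψ (i := some i) h).symm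

end ControlledQuery

theorem mul_unitary_mul_conjTranspose {Z B : Type*} [Fintype B] [DecidableEq B]
    (Ψ : Matrix Z B ℂ) (V : Matrix.unitaryGroup B ℂ) :
    Ψ * V.1 * (Ψ * V.1)ᴴ = Ψ * Ψᴴ := by
  rw [Matrix.conjTranspose_mul, Matrix.mul_assoc, ← Matrix.mul_assoc V.1,
    ← Matrix.star_eq_conjTranspose V.1, Matrix.mem_unitaryGroup_iff.1 V.2, Matrix.one_mul]

section InputRegister

variable {Z ι D O : Type*} [Fintype ι] [DecidableEq ι] [Fintype D] [DecidableEq D]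
  [AddCommGroup D] (A : Algorithm ι D O) (x : Z → ι → D) (a : Z → ℂ)

/-- The joint state `∑ z, a z |z⟩ ⊗ |ψ_t (x z)⟩` of an input register, with amplitudes `a`, and of
the algorithm after `t` queries. -/
def jointState (t : ℕ) : Matrix Z (BasisState ι D A.workDim) ℂ :=
  Matrix.of fun z b => a z * A.state (x z) t b

/-- The density matrix of the input register after `t` queries: the partial trace of the joint
state over the registers of the algorithm. -/
def inputDensity (t : ℕ) : Matrix Z Z ℂ :=
  jointState A x a t * (jointState A x a t)ᴴ

theorem jointState_succ (t : ℕ) :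
    jointState A x a (t + 1) =
      controlledQuery x (jointState A x a t) * (Matrix.UnitaryGroup.transpose (A.U (t + 1))).1 := by
  ext z b
  simp only [jointState, controlledQuery, Algorithm.state, applyQuery, Matrix.mul_apply,
    Matrix.of_apply, Matrix.mulVec, dotProduct, Finset.mul_sum,
    Matrix.UnitaryGroup.transpose_coe, Matrix.transpose_apply]
  exact Finset.sum_congr rfl fun _ _ => by ring

theorem inputDensity_zero : inputDensity A x a 0 = Matrix.vecMulVec a (star a) := by
  have hzero : jointState A x a 0 =
      Matrix.vecMulVec a (Pi.single A.start 1) * (Matrix.UnitaryGroup.transpose (A.U 0)).1 := by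
    rw [Matrix.vecMulVec_mul, Matrix.UnitaryGroup.transpose_coe, Matrix.vecMul_transpose]
    rfl
  rw [inputDensity, hzero, mul_unitary_mul_conjTranspose, Matrix.conjTranspose_vecMulVec,
    Matrix.vecMulVec_mul_vecMulVec, ← Pi.single_star, star_one, single_dotProduct,
    Pi.single_eq_same, one_mul, one_smul]

variable {A x a} [Fintype Z]

theorem expectation_inputDensity_le {G : Matrix Z Z ℂ} {C : ℝ} (hG : 0 ≤ G) (hC : 1 ≤ C)
    (hgrowth : QueryGrowthLE x G C) (t : ℕ) :
    expectation G (inputDensity A x a t) ≤ C ^ t * (star a ⬝ᵥ G *ᵥ a).re := by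
  induction t with
  | zero => rw [inputDensity_zero, expectation_vecMulVec_star, pow_zero, one_mul]
  | succ t ih =>
    rw [inputDensity, jointState_succ, mul_unitary_mul_conjTranspose, pow_succ', mul_assoc]
    exact (expectation_controlledQuery_le hG hC hgrowth _).trans (by gcongr; exact ih)

theorem sum_norm_sq_mul_outputProb_le_expectation {G : Matrix Z Z ℂ} {γ : ℝ} {g : Z → O}
    [DecidableEq O] [DecidableEq Z]
    (hGγ : ∀ o, Matrix.diagonal (fun z => if g z = o then (γ : ℂ) else 0) ≤ G) :
    γ * ∑ z, ‖a z‖ ^ 2 * A.outputProb (x z) (g z) ≤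
      expectation G (inputDensity A x a A.queries) := by
  have hw (b) : Matrix.diagonal (fun z => ((if g z = A.output b then γ else 0 : ℝ) : ℂ)) ≤ G := by
    simpa only [Complex.ofReal_zero, apply_ite Complex.ofReal] using hGγ (A.output b)
  refine le_of_eq_of_le ?_ (sum_sum_mul_norm_sq_le_expectation hw _)
  rw [Finset.sum_comm, Finset.mul_sum]
  refine Finset.sum_congr rfl fun z _ => ?_
  simp only [Algorithm.outputProb, jointState, Matrix.of_apply, norm_mul, mul_pow, Finset.mul_sum,
    ite_mul, zero_mul, eq_comm (a := g z), ← Finset.sum_filter]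
  congr!

theorem mul_le_mul_pow_queries_of_queryGrowthLE {G : Matrix Z Z ℂ} {C γ η l : ℝ} {g : Z → O}
    [DecidableEq O] [DecidableEq Z] (hG : 0 ≤ G) (hC : 1 ≤ C) (hgrowth : QueryGrowthLE x G C)
    (ha : a ≠ 0) (hGa : G *ᵥ a = (l : ℂ) • a) (hγ : 0 ≤ γ)
    (hGγ : ∀ o, Matrix.diagonal (fun z => if g z = o then (γ : ℂ) else 0) ≤ G)
    (hA : ∀ z, η ≤ A.outputProb (x z) (g z)) :
    γ * η ≤ l * C ^ A.queries := by
  have hpos : 0 < ∑ z, ‖a z‖ ^ 2 := by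
    obtain ⟨z, hz⟩ := Function.ne_iff.1 ha
    exact Finset.sum_pos' (fun _ _ => by positivity) ⟨z, Finset.mem_univ z, by positivity⟩
  have hstart : (star a ⬝ᵥ G *ᵥ a).re = l * ∑ z, ‖a z‖ ^ 2 := by
    rw [hGa, Finset.mul_sum]
    exact re_star_dotProduct_ofReal_mul (fun _ => l) a
  refine le_of_mul_le_mul_right ?_ hpos
  calc γ * η * ∑ z, ‖a z‖ ^ 2 = γ * ∑ z, ‖a z‖ ^ 2 * η := by rw [← Finset.sum_mul]; ring
    _ ≤ γ * ∑ z, ‖a z‖ ^ 2 * A.outputProb (x z) (g z) := by gcongr with z; exact hA z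
    _ ≤ expectation G (inputDensity A x a A.queries) :=
        sum_norm_sq_mul_outputProb_le_expectation hGγ
    _ ≤ C ^ A.queries * (star a ⬝ᵥ G *ᵥ a).re := expectation_inputDensity_le hG hC hgrowth _
    _ = l * C ^ A.queries * ∑ z, ‖a z‖ ^ 2 := by rw [hstart]; ring

end InputRegister

section JointInput

variable {κ ι X D : Type*}

/-- The input with `κ × ι` variables whose block of index `p` is `y (z p)`: a joint input to copies,
indexed by `κ`, of a function of the inputs `y u`. -/
def jointInput (y : X → ι → D) (z : κ → X) : κ × ι → D := fun i => y (z i.1) i.2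

variable [Fintype κ] [DecidableEq κ] [Fintype X] [DecidableEq X] {y : X → ι → D}

theorem queryGrowthLE_piKronecker {M : Matrix X X ℂ} {μ : ℝ} (hμ : 0 < μ) (hM : μ • 1 ≤ M)
    {N : ι → Matrix X X ℂ} (hN₁ : ∀ q, -1 ≤ N q) (hN₂ : ∀ q, N q ≤ 1)
    (hMN : ∀ q u u', y u q ≠ y u' q → (M + N q) u u' = 0) :
    QueryGrowthLE (jointInput y) (piKronecker ℝ fun _ : κ => M) (1 + 2 / μ) := by
  classical
  rintro ⟨p, q⟩ ρ ρ' hρ hρ' hagree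
  have hM₀ : 0 ≤ M := (smul_nonneg hμ.le zero_le_one).trans hM
  let tensor : Matrix X X ℂ →ₗ[ℝ] Matrix (κ → X) (κ → X) ℂ :=
    (piKronecker ℝ).toLinearMap (fun _ => M) p
  have htensor : tensor M = piKronecker ℝ fun _ => M :=
    congrArg (piKronecker ℝ) (Function.update_eq_self p fun _ => M)
  have hmono {σ : Matrix (κ → X) (κ → X) ℂ} (hσ : 0 ≤ σ) :
      Monotone (expectation.flip σ ∘ₗ tensor) := fun _ _ hL =>
    expectation_mono_left (piKronecker_update_mono (fun _ => hM₀) p hL) hσ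
  have hcongr {L : Matrix X X ℂ} (hL : ∀ u u', y u q ≠ y u' q → L u u' = 0) :
      (expectation.flip ρ ∘ₗ tensor) L = (expectation.flip ρ' ∘ₗ tensor) L :=
    expectation_congr_right fun z z' hne => hagree z' z <| by
      by_contra hzz'
      exact hne (piKronecker_update_apply_eq_zero ℝ (hL _ _ (Ne.symm hzz')))
  have h := le_one_add_two_div_mul_of_monotone (hmono hρ) (hmono hρ') hμ (hN₁ q) (hN₂ q) hM
    (hcongr fun u u' huu' => Matrix.one_apply_ne fun h => huu' (h ▸ rfl)) (hcongr (hMN q))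
  simpa only [LinearMap.comp_apply, LinearMap.flip_apply, htensor] using h

end JointInput

section DirectProduct

variable {κ ι X D E : Type*} [Fintype κ] [DecidableEq κ] [Fintype ι] [DecidableEq ι] [Fintype X]
  [DecidableEq X] [Fintype D] [DecidableEq D] [AddCommGroup D] [DecidableEq E]

theorem le_div_pow_mul_pow_queries {y : X → ι → D} {f : X → E} {M : Matrix X X ℂ} {v : X → ℂ}
    {N : ι → Matrix X X ℂ} {μ c η : ℝ} (hμ : 0 < μ) (hM : μ • 1 ≤ M) (hN₁ : ∀ q, -1 ≤ N q)
    (hN₂ : ∀ q, N q ≤ 1) (hMN : ∀ q u u', y u q ≠ y u' q → (M + N q) u u' = 0)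
    (hv : v ≠ 0) (hMv : M *ᵥ v = (μ : ℂ) • v) (hc : 0 < c)
    (hMc : ∀ e, Matrix.diagonal (fun u => if f u = e then (c : ℂ) else 0) ≤ M)
    (A : Algorithm (κ × ι) D (κ → E))
    (hA : ∀ z, η ≤ A.outputProb (jointInput y z) fun p => f (z p)) :
    η ≤ (μ / c) ^ Fintype.card κ * (1 + 2 / μ) ^ A.queries := by
  have hM₀ : 0 ≤ M := (smul_nonneg hμ.le zero_le_one).trans hM
  let a : (κ → X) → ℂ := fun z => ∏ p, v (z p)
  have ha : a ≠ 0 := by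
    obtain ⟨u, hu⟩ := Function.ne_iff.1 hv
    exact Function.ne_iff.2 ⟨fun _ => u, Finset.prod_ne_zero_iff.2 fun _ _ => hu⟩
  have hGa : (piKronecker ℝ fun _ : κ => M) *ᵥ a = ((μ ^ Fintype.card κ : ℝ) : ℂ) • a := by
    rw [piKronecker_mulVec]
    ext z
    simp only [hMv, a, Pi.smul_apply, smul_eq_mul, Finset.prod_mul_distrib, Finset.prod_const,
      Finset.card_univ, Complex.ofReal_pow]
  have hbound : c ^ Fintype.card κ * η ≤ μ ^ Fintype.card κ * (1 + 2 / μ) ^ A.queries :=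
    mul_le_mul_pow_queries_of_queryGrowthLE (piKronecker_nonneg ℝ fun _ => hM₀)
      (le_add_of_nonneg_right (by positivity)) (queryGrowthLE_piKronecker hμ hM hN₁ hN₂ hMN) ha
      hGa (by positivity) (fun o => diagonal_pow_le_piKronecker hc.le hMc o) hA
  rwa [div_pow, div_mul_eq_mul_div, le_div_iff₀' (by positivity)]

end DirectProduct

section FibreSign

variable {X E : Type*} [DecidableEq X] [DecidableEq E]

/-- The diagonal unitary with entries `1` on the fibre of `f` over `o` and `-1` outside it.
Conjugation by it negates the entries between that fibre and its complement. -/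
def fibreSign (f : X → E) (o : E) : Matrix X X ℂ :=
  Matrix.diagonal fun x => if f x = o then 1 else -1

theorem isSelfAdjoint_fibreSign (f : X → E) (o : E) : IsSelfAdjoint (fibreSign f o) := by
  refine Matrix.isHermitian_diagonal_of_self_adjoint _ (funext fun x => ?_)
  simp only [Pi.star_apply, apply_ite star, star_one, star_neg]

theorem half_smul_one_add_fibreSign (f : X → E) (o : E) :
    (1 / 2 : ℝ) • (1 + fibreSign f o) = Matrix.diagonal fun x => if f x = o then 1 else 0 := by
  rw [fibreSign, ← Matrix.diagonal_one, Matrix.diagonal_add, ← Matrix.diagonal_smul]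
  congr 1
  ext x
  simp only [Pi.smul_apply]
  split_ifs <;> norm_num

variable [Fintype X]

theorem fibreSign_mul_self (f : X → E) (o : E) : fibreSign f o * fibreSign f o = 1 := by
  rw [fibreSign, Matrix.diagonal_mul_diagonal, ← Matrix.diagonal_one]
  congr 1
  ext x
  split_ifs <;> norm_num

theorem diagonal_fibre_le_smul_one_sub {f : X → E} {e : E} {H : Matrix X X ℂ}
    (hH : fibreSign f e * H * fibreSign f e = -H) {d μ : ℝ} (hd : 0 < d) (hμ : 0 < μ)
    (hHd : H ≤ d • 1) :
    Matrix.diagonal (fun u => if f u = e then ((μ * (2 * d + μ) / (d + μ) : ℝ) : ℂ) else 0) ≤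
      (d + μ) • 1 - H := by
  refine le_of_eq_of_le ?_ (smul_half_one_add_le_smul_one_sub (isSelfAdjoint_fibreSign f e)
    (fibreSign_mul_self f e) hH hd hμ hHd)
  rw [half_smul_one_add_fibreSign, ← Matrix.diagonal_smul]
  congr! with u
  simp only [Pi.smul_apply, smul_ite, Complex.real_smul, mul_one, smul_zero]

end FibreSign

section BooleanFunction

variable {ι D E : Type*} [DecidableEq E] {S : Finset (ι → D)}

theorem isSelfAdjoint_hadamard_functionGram {Γ : Matrix S S ℂ} (hΓ : Γ.IsHermitian) (f : S → E) :
    IsSelfAdjoint (Γ ⊙ (allOnes S - functionGram f)) := by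
  refine hΓ.hadamard (.ext fun u u' => ?_)
  simp [allOnes, functionGram, eq_comm, apply_ite]

variable [Fintype E] [DecidableEq S]

theorem hadamard_allOnes_sub_functionGram (hE : Fintype.card E = 2) (f : S → E) (o : E)
    (Γ : Matrix S S ℂ) :
    Γ ⊙ (allOnes S - functionGram f) = (1 / 2 : ℝ) • (Γ - fibreSign f o * Γ * fibreSign f o) := by
  have huniq : ∃! e, e ≠ o := (Nat.card_eq_two_iff' o).1 (Nat.card_eq_fintype_card.trans hE)
  ext u u'
  simp only [fibreSign, Matrix.hadamard_apply, Matrix.sub_apply, Matrix.smul_apply,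
    Matrix.mul_diagonal, Matrix.diagonal_mul, allOnes, functionGram, Matrix.of_apply]
  by_cases hu : f u = o <;> by_cases hu' : f u' = o
  · simp [hu, hu']
  · simp only [hu, hu', Ne.symm hu', ↓reduceIte, Complex.real_smul]
    push_cast
    ring
  · simp only [hu, hu', ↓reduceIte, Complex.real_smul]
    push_cast
    ring
  · simp [hu', huniq.unique hu hu']

theorem conj_hadamard_functionGram (hE : Fintype.card E = 2) (f : S → E) (o : E)
    (Γ : Matrix S S ℂ) :
    fibreSign f o * (Γ ⊙ (allOnes S - functionGram f)) * fibreSign f o =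
      -(Γ ⊙ (allOnes S - functionGram f)) := by
  rw [hadamard_allOnes_sub_functionGram hE f o, conj_half_sub_conj (fibreSign_mul_self f o)]

end BooleanFunction

section AdversaryMatrix

variable {ι D E : Type*} [Fintype ι] [DecidableEq ι] [DecidableEq D] [Fintype E] [DecidableEq E]
  {S : Finset (ι → D)} {f : S → E} {Γ : Matrix S S ℂ}

theorem hadamard_functionGram_agree_mem_Icc (hE : Fintype.card E = 2) (f : S → E)
    (hΓ : IsAdversaryMatrix Γ) (q : ι) :
    Γ ⊙ (allOnes S - functionGram f) ⊙ (allOnes S - agree S q) ∈ Set.Icc (-1) 1 := by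
  obtain ⟨o⟩ : Nonempty E := Fintype.card_pos_iff.1 (hE ▸ two_pos)
  have hlower : -1 ≤ Γ ⊙ (allOnes S - agree S q) :=
    neg_le_iff_add_nonneg'.2 (hΓ.2 q).1.nonneg
  have hupper : Γ ⊙ (allOnes S - agree S q) ≤ 1 := sub_nonneg.1 (hΓ.2 q).2.nonneg
  rw [Matrix.hadamard_assoc, Matrix.hadamard_comm (allOnes S - _), ← Matrix.hadamard_assoc,
    hadamard_allOnes_sub_functionGram hE f o]
  exact ⟨neg_one_le_half_sub_conj (isSelfAdjoint_fibreSign f o) (fibreSign_mul_self f o) hlower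
    hupper, half_sub_conj_le (isSelfAdjoint_fibreSign f o) (fibreSign_mul_self f o) hlower hupper⟩

theorem success_le_of_isAdversaryMatrix {κ : Type*} [Fintype κ] [DecidableEq κ] [Fintype D]
    [AddCommGroup D] (hE : Fintype.card E = 2) (hΓ : IsAdversaryMatrix Γ) {d μ η : ℝ}
    (hd : ‖Γ ⊙ (allOnes S - functionGram f)‖ = d) (hd₀ : 0 < d) (hμ : 0 < μ)
    (A : Algorithm (κ × ι) D (κ → E))
    (hA : ∀ z, η ≤ A.outputProb (jointInput (fun u : S => u.1) z) fun p => f (z p)) :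
    η ≤ ((d + μ) / (2 * d + μ)) ^ Fintype.card κ * (1 + 2 / μ) ^ A.queries := by
  set H := Γ ⊙ (allOnes S - functionGram f) with hH
  have hself : IsSelfAdjoint H := isSelfAdjoint_hadamard_functionGram hΓ.1 f
  have hWH (e : E) : fibreSign f e * H * fibreSign f e = -H := conj_hadamard_functionGram hE f e Γ
  have hHd : H ≤ d • 1 := by
    simpa only [hd, Algebra.algebraMap_eq_smul_one] using hself.le_algebraMap_norm_self
  obtain ⟨e₀⟩ : Nonempty E := Fintype.card_pos_iff.1 (hE ▸ two_pos)
  have _ : Nonempty S := by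
    by_contra h
    rw [not_nonempty_iff] at h
    exact hd₀.ne (by rw [← hd, Subsingleton.elim H 0, norm_zero])
  obtain ⟨v, hv, hHv⟩ :=
    exists_mulVec_eq_norm_smul_of_conj_eq_neg hself (fibreSign_mul_self f e₀) (hWH e₀)
  have hMv : ((d + μ) • 1 - H) *ᵥ v = (μ : ℂ) • v := by
    rw [Matrix.sub_mulVec, Matrix.smul_mulVec, Matrix.one_mulVec, hHv, hd, add_smul,
      Complex.coe_smul, Complex.coe_smul, add_sub_cancel_left]
  have hN := hadamard_functionGram_agree_mem_Icc hE f hΓ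
  have hbound := le_div_pow_mul_pow_queries hμ ?_ (fun q => (hN q).1) (fun q => (hN q).2) ?_ hv hMv
    (by positivity) (fun e => diagonal_fibre_le_smul_one_sub (hWH e) hd₀ hμ hHd) A hA
  · convert hbound using 3
    field_simp
  · rw [add_smul, le_sub_iff_add_le, add_comm]
    gcongr
  · intro q u u' huu'
    have hne : u ≠ u' := fun h => huu' (h ▸ rfl)
    simp [hH, allOnes, agree, huu', hne]

end AdversaryMatrix

section Rate

theorem mul_div_le_of_exp_mul_pow_le {k T : ℕ} {K r μ : ℝ} (hK : 0 < K) (hr : 0 < r) (hμ : 0 < μ)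
    (h : (Real.exp (1 / K) * r) ^ k ≤ r ^ k * (1 + 2 / μ) ^ T) : k * μ / (2 * K) ≤ T := by
  have hexp : Real.exp (k * (1 / K)) ≤ Real.exp (T * (2 / μ)) := by
    rw [mul_pow, mul_comm] at h
    calc Real.exp (k * (1 / K)) = Real.exp (1 / K) ^ k := Real.exp_nat_mul _ _
      _ ≤ (1 + 2 / μ) ^ T := le_of_mul_le_mul_left h (by positivity)
      _ ≤ Real.exp (2 / μ) ^ T := by
        gcongr
        rw [add_comm]
        exact Real.add_one_le_exp _
      _ = Real.exp (T * (2 / μ)) := (Real.exp_nat_mul _ _).symm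
  have hexponent := Real.exp_le_exp.1 hexp
  rw [mul_one_div, mul_div_assoc', div_le_div_iff₀ hK hμ] at hexponent
  rw [div_le_iff₀ (by positivity)]
  linarith

theorem mul_div_mul_one_sub_le_sqrt {δ k K : ℝ} (hδ₀ : 0 ≤ δ) (hδ₁ : δ < 1) (hk : 0 ≤ k)
    (hK : 0 ≤ K) : k * δ / (K * (1 - δ)) ≤ k * √δ / (K * (1 - √δ)) := by
  have hsqrt : 0 < 1 - √δ := sub_pos.2 ((Real.sqrt_lt' one_pos).2 (by rwa [one_pow]))
  have hle : δ ≤ √δ := Real.le_sqrt_of_sq_le (pow_le_of_le_one hδ₀ hδ₁.le two_ne_zero)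
  rw [mul_div_mul_comm, mul_div_mul_comm k]
  gcongr

end Rate

section BlockCopies

variable {n k : ℕ} {D E : Type*} [Fintype D] [DecidableEq D] {S : Finset (Fin n → D)}

theorem jointInput_mem_powDomain (z : Fin k → S) :
    jointInput (fun u : S => u.1) z ∈ powDomain S k :=
  Finset.mem_filter.2 ⟨Finset.mem_univ _, fun p => (z p).2⟩

variable [AddCommGroup D] [Fintype E] [DecidableEq E] {f : S → E} {Γ : Matrix S S ℂ}

theorem mul_norm_hadamard_functionGram_le_queries (hE : Fintype.card E = 2)
    (hΓ : IsAdversaryMatrix Γ) {s K : ℝ} (hs₀ : 0 ≤ s) (hs₁ : s < 1) (hK : 0 < K)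
    (A : Algorithm (Fin k × Fin n) D (Fin k → E))
    (hA : A.Computes (copies f k) (1 - (Real.exp (1 / K) * (1 + s) / 2) ^ k)) :
    k * s / (K * (1 - s)) * ‖Γ ⊙ (allOnes S - functionGram f)‖ ≤ A.queries := by
  obtain ⟨d, hd⟩ : ∃ d, ‖Γ ⊙ (allOnes S - functionGram f)‖ = d := ⟨_, rfl⟩
  rw [hd]
  rcases hs₀.eq_or_lt with rfl | hs
  · simp
  rcases (hd ▸ norm_nonneg _ : 0 ≤ d).eq_or_lt with rfl | hd₀
  · simp
  have hs' : 0 < 1 - s := sub_pos.2 hs₁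
  -- With this `μ` the ratio `(d + μ) / (2 * d + μ)` is `(1 + s) / 2`.
  let μ := 2 * d * s / (1 - s)
  have hμ : 0 < μ := by positivity
  have hratio : (d + μ) / (2 * d + μ) = (1 + s) / 2 := by
    simp only [μ]
    field_simp
    ring
  have hsuccess : (Real.exp (1 / K) * (1 + s) / 2) ^ k ≤
      ((1 + s) / 2) ^ k * (1 + 2 / μ) ^ A.queries := by
    rw [← hratio]
    simpa only [Fintype.card_fin] using success_le_of_isAdversaryMatrix hE hΓ hd hd₀ hμ A fun z =>
      (sub_sub_cancel _ _).symm.trans_le (hA ⟨_, jointInput_mem_powDomain z⟩)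
  rw [mul_div_assoc] at hsuccess
  calc k * s / (K * (1 - s)) * d = k * μ / (2 * K) := by simp only [μ]; field_simp
    _ ≤ A.queries := mul_div_le_of_exp_mul_pow_le hK (by positivity) hμ hsuccess

end BlockCopies

end QuantumQuery

open QuantumQuery in
theorem mainTheorem9_general {n : ℕ} {D E : Type*} [Fintype D] [DecidableEq D] [AddCommGroup D]
    [Fintype E] [DecidableEq E] (hE : Fintype.card E = 2) (S : Finset (Fin n → D)) (f : S → E)
    {s : ℝ} (hs₀ : 0 ≤ s) (hs₁ : s < 1) (k : ℕ) {K : ℝ} (hK : 0 < K) :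
    ENNReal.ofReal (k * s / (K * (1 - s))) * additiveAdversary (functionGram f) ≤
      (queryComplexity (1 - (Real.exp (1 / K) * (1 + s) / 2) ^ k) (copies f k) : ℝ≥0∞) := by
  have : 0 < 1 - s := sub_pos.2 hs₁
  simp only [queryComplexity, additiveAdversary, ENat.toENNReal_iInf, ENNReal.mul_iSup]
  refine le_iInf₂ fun A hA => iSup₂_le fun Γ hΓ => ?_
  rw [← ENNReal.ofReal_mul (by positivity), Matrix.l2_opNorm_toEuclideanCLM, ENat.toENNReal_coe,
    ← ENNReal.ofReal_natCast]
  exact ENNReal.ofReal_le_ofReal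
    (mul_norm_hadamard_functionGram_le_queries hE hΓ hs₀ hs₁ hK A hA)

theorem mainTheorem9 {n : ℕ} {D E : Type*} [Fintype D] [DecidableEq D] [AddCommGroup D]
    [Fintype E] [DecidableEq E] (hE : Fintype.card E = 2)
    (S : Finset (Fin n → D)) (f : S → E)
    (δ : ℝ) (hδ0 : 0 ≤ δ) (hδ1 : δ < 1) (k K : ℕ) (hk : 0 < k) (hK : 0 < K) :
    ENNReal.ofReal ((k : ℝ) * δ / ((K : ℝ) * (1 - δ))) *
        QuantumQuery.additiveAdversary (QuantumQuery.functionGram f) ≤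
      ((QuantumQuery.queryComplexity
          (1 - (Real.exp (1 / (K : ℝ)) * (1 + √δ) / 2) ^ k)
          (QuantumQuery.copies f k) : ℕ∞) : ℝ≥0∞) := by
  grw [QuantumQuery.mul_div_mul_one_sub_le_sqrt hδ0 hδ1 k.cast_nonneg K.cast_nonneg]
  exact mainTheorem9_general hE S f (Real.sqrt_nonneg δ)
    ((Real.sqrt_lt' one_pos).2 (by rwa [one_pow])) k (Nat.cast_pos.2 hK)
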